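/- Let $(\mathcal C,\mathbb E,\mathfrak s)$ be an extriangulated category in the sense of Nakaoka and Palu, and let $\xi$ be a proper class of $\mathbb E$-triangles: $\xi$ is closed under isomorphisms, finite coproducts, base change and cobase change, contains all split $\mathbb E$-triangles, and is saturated (if $A_i\xrightarrow{x_i}B_i\xrightarrow{y_i}C\overset{\delta_i}{\dashrightarrow}$, $i=1,2$, are $\mathbb E$-triangles such that the second one and the $\mathbb E$-triangle $A_1\to M\to B_2\overset{y_2^*\delta_1}{\dashrightarrow}$ belong to $\xi$, then the first one belongs to $\xi$). Call $P$ $\xi$-projective if $\mathcal C(P,-)$ sends every $\mathbb E$-triangle $A\to B\to C\dashrightarrow$ in $\xi$ to a short exact sequence $0\to\mathcal C(P,A)\to\mathcal C(P,B)\to\mathcal C(P,C)\to0$; $\xi$-injectives are defined dually. Assume that $\mathcal C$ has enough $\xi$-projectives and enough $\xi$-injectives (for every object $A$ there are $\mathbb E$-triangles $K\to P\to A\dashrightarrow$ and $A\to I\to K'\dashrightarrow$ in $\xi$ with $P$ $\xi$-projective and $I$ $\xi$-injective), and that Condition (WIC) holds: for composable morphisms $f,g$, if $gf$ is an inflation then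 so is $f$, and if $gf$ is a deflation then so is $g$. Let $\mathcal W$ be a class of objects of $\mathcal C$ closed under isomorphisms and finite direct sums. For a class $\mathcal V$ of objects, a complete $\mathcal V(\xi)$-resolution of an object $X$ is a complex $\cdots\to V_1\xrightarrow{d_1}V_0\xrightarrow{d_0}V_{-1}\to\cdots$, indexed by $\mathbb Z$, with all $V_n\in\mathcal V$, for which there are $\mathbb E$-triangles $K_{n+1}\xrightarrow{g_n}V_n\xrightarrow{f_n}K_n\dashrightarrow$ ($n\in\mathbb Z$) in $\xi$ with $d_n=g_{n-1}f_n$ and $K_0\cong X$, such that for all $V\in\mathcal V$ and $n\in\mathbb Z$ the sequences $$0\to\mathcal C(V,K_{n+1})\to\mathcal C(V,V_n)\to\mathcal C(V,K_n)\to0,\qquad 0\to\mathcal C(K_n,V)\to\mathcal C(V_n,V)\to\mathcal C(K_{n+1},V)\to0$$ are exact. Let $\mathcal G\mathcal V(\xi)$ be the class of objects that admit a complete $\mathcal V(\xi)$-resolution, and put $\mathcal{GW}^1(\xi)=\mathcal{GW}(\xi)$ and $\mathcal{GW}^{n+1}(\xi)=\mathcal G(\mathcal{GW}^n(\xi))(\xi)$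 for $n\ge1$. Then: (1) $\mathcal{GW}^n(\xi)=\mathcal{GW}(\xi)$ for every $n\ge 1$; (2) $\mathcal{GW}(\xi)$ is closed under direct summands. -/

import Mathlib

open CategoryTheory CategoryTheory.Limits Opposite

universe w v u

namespace Extri

/-! ### Extriangulated categories -/

section Extriangulated

variable {C : Type u} [Category.{v} C]

/-- A sequence `A ⟶ B ⟶ Z` with fixed end terms. -/
structure Seq (A Z : C) where
  B : C
  x : A ⟶ B
  y : B ⟶ Z

/-- Two sequences with the same end terms are equivalent if their middle terms are isomorphic
compatibly with the identities of the end terms. -/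
def Seq.Equivalent {A Z : C} (S T : Seq A Z) : Prop :=
  ∃ b : S.B ≅ T.B, S.x ≫ b.hom = T.x ∧ b.hom ≫ T.y = S.y

theorem Seq.equivalent_equivalence (A Z : C) : Equivalence (@Seq.Equivalent C _ A Z) where
  refl S := ⟨Iso.refl _, by simp, by simp⟩
  symm := by
    rintro S T ⟨b, h1, h2⟩
    exact ⟨b.symm, by simp [← h1], by simp [← h2]⟩
  trans := by
    rintro S T U ⟨b, h1, h2⟩ ⟨b', h1', h2'⟩
    exact ⟨b ≪≫ b', by simp [← h1', ← h1], by simp [← h2, ← h2']⟩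

instance Seq.setoid (A Z : C) : Setoid (Seq A Z) := ⟨Seq.Equivalent, Seq.equivalent_equivalence A Z⟩

/-- The class `[A ⟶ B ⟶ Z]` of a sequence. -/
def seqClass {A B Z : C} (x : A ⟶ B) (y : B ⟶ Z) : Quotient (Seq.setoid A Z) :=
  Quotient.mk _ ⟨B, x, y⟩

/-- The group `𝔼(Z, A)` of extensions. -/
abbrev Ext (E : Cᵒᵖ ⥤ C ⥤ AddCommGrpCat.{w}) (Z A : C) : Type w := (E.obj (op Z)).obj A

/-- `c^* : 𝔼(Z, A) → 𝔼(Z', A)` for `c : Z' ⟶ Z`. -/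
def pull (E : Cᵒᵖ ⥤ C ⥤ AddCommGrpCat.{w}) {Z Z' A : C} (c : Z' ⟶ Z) : Ext E Z A →+ Ext E Z' A :=
  ((E.map c.op).app A).hom

/-- `a_* : 𝔼(Z, A) → 𝔼(Z, A')` for `a : A ⟶ A'`. -/
def push (E : Cᵒᵖ ⥤ C ⥤ AddCommGrpCat.{w}) {Z A A' : C} (a : A ⟶ A') : Ext E Z A →+ Ext E Z A' :=
  ((E.obj (op Z)).map a).hom

variable [Preadditive C] [HasZeroObject C] [HasBinaryBiproducts C]

/-- The direct sum `δ ⊕ δ'` in `𝔼(Z ⊕ Z', A ⊕ A')`. -/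
noncomputable def extSum (E : Cᵒᵖ ⥤ C ⥤ AddCommGrpCat.{w}) {Z A Z' A' : C}
    (δ : Ext E Z A) (δ' : Ext E Z' A') : Ext E (Z ⊞ Z') (A ⊞ A') :=
  push E biprod.inl (pull E biprod.fst δ) + push E biprod.inr (pull E biprod.snd δ')

variable (C) in
/-- An extriangulated structure on the additive category `C`, in the sense of Nakaoka and Palu. -/
structure ExtriangulatedStructure where
  /-- (ET1): the additive bifunctor `𝔼`. -/
  E : Cᵒᵖ ⥤ C ⥤ AddCommGrpCat.{w}
  additive_left : E.Additive
  additive_right : ∀ Z : Cᵒᵖ, (E.obj Z).Additive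
  /-- The correspondence `𝔰`. -/
  s : ∀ {Z A : C}, Ext E Z A → Quotient (Seq.setoid A Z)
  /-- (ET2): `𝔰` is a realization: every morphism of extensions lifts to the realizations. -/
  realization : ∀ {A B Z A' B' Z' : C} (x : A ⟶ B) (y : B ⟶ Z) (x' : A' ⟶ B') (y' : B' ⟶ Z')
    (δ : Ext E Z A) (δ' : Ext E Z' A'), s δ = seqClass x y → s δ' = seqClass x' y' →
    ∀ (a : A ⟶ A') (c : Z ⟶ Z'), push E a δ = pull E c δ' →
      ∃ b : B ⟶ B', x ≫ b = a ≫ x' ∧ y ≫ c = b ≫ y'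
  /-- (ET2): the realization is additive. -/
  s_zero : ∀ A Z : C,
    s (0 : Ext E Z A) = seqClass (biprod.inl : A ⟶ A ⊞ Z) (biprod.snd : A ⊞ Z ⟶ Z)
  s_sum : ∀ {A B Z A' B' Z' : C} (x : A ⟶ B) (y : B ⟶ Z) (x' : A' ⟶ B') (y' : B' ⟶ Z')
    (δ : Ext E Z A) (δ' : Ext E Z' A'), s δ = seqClass x y → s δ' = seqClass x' y' →
    s (extSum E δ δ') = seqClass (biprod.map x x') (biprod.map y y')
  et3 : ∀ {A B Z A' B' Z' : C} (x : A ⟶ B) (y : B ⟶ Z) (x' : A' ⟶ B') (y' : B' ⟶ Z')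
    (δ : Ext E Z A) (δ' : Ext E Z' A'), s δ = seqClass x y → s δ' = seqClass x' y' →
    ∀ (a : A ⟶ A') (b : B ⟶ B'), x ≫ b = a ≫ x' →
      ∃ c : Z ⟶ Z', y ≫ c = b ≫ y' ∧ push E a δ = pull E c δ'
  et3_op : ∀ {A B Z A' B' Z' : C} (x : A ⟶ B) (y : B ⟶ Z) (x' : A' ⟶ B') (y' : B' ⟶ Z')
    (δ : Ext E Z A) (δ' : Ext E Z' A'), s δ = seqClass x y → s δ' = seqClass x' y' →
    ∀ (b : B ⟶ B') (c : Z ⟶ Z'), y ≫ c = b ≫ y' →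
      ∃ a : A ⟶ A', x ≫ b = a ≫ x' ∧ push E a δ = pull E c δ'
  et4 : ∀ {A B D Z F : C} (f : A ⟶ B) (f' : B ⟶ D) (g : B ⟶ Z) (g' : Z ⟶ F)
    (δ : Ext E D A) (δ' : Ext E F B), s δ = seqClass f f' → s δ' = seqClass g g' →
      ∃ (G : C) (h' : Z ⟶ G) (d : D ⟶ G) (e : G ⟶ F) (δ'' : Ext E G A),
        s δ'' = seqClass (f ≫ g) h' ∧ f' ≫ d = g ≫ h' ∧ h' ≫ e = g' ∧
        s (push E f' δ') = seqClass d e ∧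
        pull E d δ'' = δ ∧
        push E f δ'' = pull E e δ'
  et4_op : ∀ {A B D Z F : C} (f' : D ⟶ A) (f : A ⟶ B) (g' : F ⟶ B) (g : B ⟶ Z)
    (δ : Ext E B D) (δ' : Ext E Z F), s δ = seqClass f' f → s δ' = seqClass g' g →
      ∃ (G : C) (h' : G ⟶ A) (d : D ⟶ G) (e : G ⟶ F) (δ'' : Ext E Z G),
        s δ'' = seqClass h' (f ≫ g) ∧ d ≫ h' = f' ∧ h' ≫ f = e ≫ g' ∧
        s (pull E g' δ) = seqClass d e ∧
        push E e δ'' = δ' ∧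
        push E d δ = pull E g δ''

end Extriangulated

/-! ### Proper classes -/

section Proper

variable {C : Type u} [Category.{v} C] [Preadditive C] [HasZeroObject C] [HasBinaryBiproducts C]
variable (S : ExtriangulatedStructure.{w} C)

/-- `A --x--> B --y--> Z --δ-->` is an `𝔼`-triangle. -/
def IsTriangle {A B Z : C} (x : A ⟶ B) (y : B ⟶ Z) (δ : Ext S.E Z A) : Prop :=
  S.s δ = seqClass x y

def IsInflation {A B : C} (x : A ⟶ B) : Prop :=
  ∃ (Z : C) (y : B ⟶ Z) (δ : Ext S.E Z A), IsTriangle S x y δ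

def IsDeflation {B Z : C} (y : B ⟶ Z) : Prop :=
  ∃ (A : C) (x : A ⟶ B) (δ : Ext S.E Z A), IsTriangle S x y δ

/-- Condition (WIC). -/
structure WIC : Prop where
  inflation : ∀ {A B Z : C} (f : A ⟶ B) (g : B ⟶ Z), IsInflation S (f ≫ g) → IsInflation S f
  deflation : ∀ {A B Z : C} (f : A ⟶ B) (g : B ⟶ Z), IsDeflation S (f ≫ g) → IsDeflation S g

/-- A collection of data `A --x--> B --y--> Z --δ-->`; for a proper class all of them are
`𝔼`-triangles. -/
abbrev TriangleClass : Type (max u v w) :=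
  ∀ ⦃A B Z : C⦄, (A ⟶ B) → (B ⟶ Z) → Ext S.E Z A → Prop

variable {S}

/-- `ξ` is a proper class of `𝔼`-triangles. -/
structure IsProperClass (ξ : TriangleClass S) : Prop where
  isTriangle : ∀ {A B Z : C} {x : A ⟶ B} {y : B ⟶ Z} {δ : Ext S.E Z A},
    ξ x y δ → IsTriangle S x y δ
  /-- Closure under isomorphisms of `𝔼`-triangles. -/
  of_iso : ∀ {A B Z A' B' Z' : C} {x : A ⟶ B} {y : B ⟶ Z} {δ : Ext S.E Z A}
    {x' : A' ⟶ B'} {y' : B' ⟶ Z'} {δ' : Ext S.E Z' A'} (a : A ≅ A') (b : B ≅ B') (c : Z ≅ Z'),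
    ξ x y δ → IsTriangle S x' y' δ' →
    x ≫ b.hom = a.hom ≫ x' → y ≫ c.hom = b.hom ≫ y' →
    push S.E a.hom δ = pull S.E c.hom δ' → ξ x' y' δ'
  /-- All split `𝔼`-triangles belong to `ξ`. -/
  split : ∀ {A B Z : C} {x : A ⟶ B} {y : B ⟶ Z},
    IsTriangle S x y (0 : Ext S.E Z A) → ξ x y (0 : Ext S.E Z A)
  /-- Closure under finite coproducts (the empty coproduct is a split `𝔼`-triangle). -/
  sum : ∀ {A B Z A' B' Z' : C} {x : A ⟶ B} {y : B ⟶ Z} {δ : Ext S.E Z A}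
    {x' : A' ⟶ B'} {y' : B' ⟶ Z'} {δ' : Ext S.E Z' A'}, ξ x y δ → ξ x' y' δ' →
    ξ (biprod.map x x') (biprod.map y y') (extSum S.E δ δ')
  base_change : ∀ {A B Z B' Z' : C} {x : A ⟶ B} {y : B ⟶ Z} {δ : Ext S.E Z A} (c : Z' ⟶ Z)
    {x' : A ⟶ B'} {y' : B' ⟶ Z'}, ξ x y δ → IsTriangle S x' y' (pull S.E c δ) →
    ξ x' y' (pull S.E c δ)
  cobase_change : ∀ {A B Z A' B' : C} {x : A ⟶ B} {y : B ⟶ Z} {δ : Ext S.E Z A} (a : A ⟶ A')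
    {x' : A' ⟶ B'} {y' : B' ⟶ Z}, ξ x y δ → IsTriangle S x' y' (push S.E a δ) →
    ξ x' y' (push S.E a δ)
  /-- Saturation: for `𝔼`-triangles `δ₁`, `δ₂` over the same object, if `δ₂` and the pullback
  `y₂^* δ₁` belong to `ξ`, so does `δ₁`. -/
  saturated : ∀ {Z A₁ B₁ A₂ B₂ M : C} {x₁ : A₁ ⟶ B₁} {y₁ : B₁ ⟶ Z} {δ₁ : Ext S.E Z A₁}
    {x₂ : A₂ ⟶ B₂} {y₂ : B₂ ⟶ Z} {δ₂ : Ext S.E Z A₂} {m₁ : A₁ ⟶ M} {e₁ : M ⟶ B₂},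
    IsTriangle S x₁ y₁ δ₁ → ξ x₂ y₂ δ₂ → ξ m₁ e₁ (pull S.E y₂ δ₁) → ξ x₁ y₁ δ₁

end Proper

/-! ### Relative projectives and injectives -/

section Exactness

variable {C : Type u} [Category.{v} C] [Preadditive C]

/-- `0 → C(W, A) → C(W, B) → C(W, Z) → 0` is exact. -/
def HomFromExact (W : C) {A B Z : C} (x : A ⟶ B) (y : B ⟶ Z) : Prop :=
  Function.Injective (fun f : W ⟶ A => f ≫ x) ∧
  Function.Exact (fun f : W ⟶ A => f ≫ x) (fun f : W ⟶ B => f ≫ y) ∧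
  Function.Surjective (fun f : W ⟶ B => f ≫ y)

/-- `0 → C(Z, W) → C(B, W) → C(A, W) → 0` is exact. -/
def HomToExact (W : C) {A B Z : C} (x : A ⟶ B) (y : B ⟶ Z) : Prop :=
  Function.Injective (fun f : Z ⟶ W => y ≫ f) ∧
  Function.Exact (fun f : Z ⟶ W => y ≫ f) (fun f : B ⟶ W => x ≫ f) ∧
  Function.Surjective (fun f : B ⟶ W => x ≫ f)

variable [HasZeroObject C] [HasBinaryBiproducts C] {S : ExtriangulatedStructure.{w} C} (ξ : TriangleClass S)

def IsXiProjective (P : C) : Prop :=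
  ∀ ⦃A B Z : C⦄ (x : A ⟶ B) (y : B ⟶ Z) (δ : Ext S.E Z A), ξ x y δ → HomFromExact P x y

def IsXiInjective (I : C) : Prop :=
  ∀ ⦃A B Z : C⦄ (x : A ⟶ B) (y : B ⟶ Z) (δ : Ext S.E Z A), ξ x y δ → HomToExact I x y

def EnoughXiProjectives : Prop :=
  ∀ A : C, ∃ (K P : C) (x : K ⟶ P) (y : P ⟶ A) (δ : Ext S.E A K),
    ξ x y δ ∧ IsXiProjective ξ P

def EnoughXiInjectives : Prop :=
  ∀ A : C, ∃ (I K : C) (x : A ⟶ I) (y : I ⟶ K) (δ : Ext S.E K A),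
    ξ x y δ ∧ IsXiInjective ξ I

/-! ### The Gorenstein category -/

/-- A decomposition of a complex into `𝔼`-triangles `K (n+1) --g n--> X n --f n--> K n` in `ξ`,
with `d : X (n+1) ⟶ X n` equal to `f (n+1)` followed by `g n`. A complex is `ξ`-exact
if it has such a decomposition. -/
structure XiDecomposition (X : ChainComplex C ℤ) where
  K : ℤ → C
  g : ∀ n : ℤ, K (n + 1) ⟶ X.X n
  f : ∀ n : ℤ, X.X n ⟶ K n
  δ : ∀ n : ℤ, Ext S.E (K n) (K (n + 1))
  mem : ∀ n : ℤ, ξ (g n) (f n) (δ n)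
  d_eq : ∀ n : ℤ, X.d (n + 1) n = f (n + 1) ≫ g n

/-- A complete `W(ξ)`-resolution of `G`: a complex `⋯ → X 1 → X 0 → X (-1) → ⋯` in `W`, decomposed
into `𝔼`-triangles in `ξ` that are `C(W, -)`-exact and `C(-, W)`-exact, in which `G` is
(up to isomorphism) the term `K 0` of `K 1 → X 0 → K 0` and `K 0 → X (-1) → K (-1)`. -/
structure CompleteResolution (W : ObjectProperty C) (G : C) where
  X : ChainComplex C ℤ
  mem : ∀ n : ℤ, W (X.X n)
  decomp : XiDecomposition ξ X
  homFrom_exact : ∀ V : C, W V → ∀ n : ℤ, HomFromExact V (decomp.g n) (decomp.f n)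
  homTo_exact : ∀ V : C, W V → ∀ n : ℤ, HomToExact V (decomp.g n) (decomp.f n)
  iso : decomp.K 0 ≅ G

/-- The Gorenstein category `GW(ξ)`. -/
def Gorenstein (W : ObjectProperty C) : ObjectProperty C :=
  fun G => Nonempty (CompleteResolution ξ W G)

/-- `GW^n(ξ)`: `GW^1(ξ) = GW(ξ)` and `GW^{n+1}(ξ) = G(GW^n(ξ))`; the value at `0` is `W`. -/
def GorensteinPow (W : ObjectProperty C) : ℕ → ObjectProperty C
  | 0 => W
  | n + 1 => Gorenstein ξ (GorensteinPow W n)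

/-- Closure under direct summands. -/
def ClosedUnderSummands (P : ObjectProperty C) : Prop :=
  ∀ G H H' : C, Nonempty (G ≅ H ⊞ H') → P G → P H

/-- Closure under direct sums of two objects; the zero object need not belong to `W`. -/
def ClosedUnderSums (W : ObjectProperty C) : Prop :=
  ∀ A B : C, W A → W B → W (A ⊞ B)

end Exactness

end Extri

/-! Call a triangle in `ξ` a conflation if it is exact under Hom from and to every object of `W`. An
object is Gorenstein exactly when it has both a left and a right resolution by `W` spliced from
conflations (`gorenstein_iff`), so each side can be treated alone, the other following by duality.
Conflations have pullbacks, pushouts and composites, and split when an end term lies in `W`;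
`ConflationCalculus` records this, and the rest of the argument is formal.

The core is `leftResolved_of_leftResolved`. Suppose `Y` is resolved by left resolved objects,
beginning with `Y₁ ⟶ G ⟶ Y`, and let `G' ⟶ V ⟶ G` begin a resolution of `G` by `W`. The syzygy `K`
of `V ⟶ Y` is an extension of `Y₁` by `G'`. Pulling back along the next term `G₁ ⟶ Y₁` and using the
horseshoe lemma, `K` is again resolved by left resolved objects, so the process continues.

For (1), `W` lies in `GW(ξ)`, so conflations relative to `GW(ξ)` are conflations relative to `W`,
and the core applies on both sides. For (2), if `G` is `H ⊞ H'`, then `H` is resolved by `G, G, G,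
…` with syzygies alternating between `H'` and `H`, and the core applies again. -/

namespace Extri

/-! ### The calculus of conflations -/

/-- The formal properties of a ternary relation `T A B Z` ("there is a suitable conflation
`A ⟶ B ⟶ Z`") and a class `W` that are used to compare resolutions. They are self-dual. -/
structure ConflationCalculus {O : Type*} (T : O → O → O → Prop) (W : O → Prop) : Prop where
  pullback : ∀ {K V X Y U : O}, T K V X → T Y U X → ∃ M, T K M U ∧ T Y M V
  pushout : ∀ {A U Z V Z' : O}, T A U Z → T A V Z' → ∃ M, T U M Z' ∧ T V M Z
  comp_deflation : ∀ {K V P Q X : O}, T K V P → T Q P X → ∃ N, T N V X ∧ T K N Q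
  comp_inflation : ∀ {X P Q V K : O}, T X P Q → T P V K → ∃ N, T X V N ∧ T Q N K
  swap_right : ∀ {K M V : O}, W V → T K M V → T V M K
  swap_left : ∀ {K M V : O}, W V → T V M K → T K M V
  mid_mem : ∀ {V M V' : O}, W V → W V' → T V M V' → W M

/-- `X` has an infinite left resolution by objects of `W`, spliced from conflations in `T`. -/
def LeftResolved {O : Type*} (T : O → O → O → Prop) (W : O → Prop) (X : O) : Prop :=
  ∃ P : O → Prop, P X ∧ ∀ Y, P Y → ∃ V K, W V ∧ T K V Y ∧ P K

theorem LeftResolved.step {O : Type*} {T : O → O → O → Prop} {W : O → Prop} {X : O}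
    (h : LeftResolved T W X) : ∃ V K, W V ∧ T K V X ∧ LeftResolved T W K := by
  obtain ⟨P, hX, hP⟩ := h
  obtain ⟨V, K, hV, hT, hK⟩ := hP X hX
  exact ⟨V, K, hV, hT, P, hK, hP⟩

theorem LeftResolved.exists_seq {O : Type*} {T : O → O → O → Prop} {W : O → Prop} {X : O}
    (h : LeftResolved T W X) :
    ∃ a : ℕ → O, a 0 = X ∧ ∀ n, ∃ V, W V ∧ T (a (n + 1)) V (a n) := by
  obtain ⟨P, hX, hP⟩ := h
  choose! V K hV hT hK using hP
  have hm : ∀ n, P (K^[n] X) := fun n => by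
    induction n with
    | zero => exact hX
    | succ n ih => rw [Function.iterate_succ_apply']; exact hK _ ih
  refine ⟨fun n => K^[n] X, rfl, fun n => ⟨V (K^[n] X), hV _ (hm n), ?_⟩⟩
  simp only [Function.iterate_succ_apply']
  exact hT _ (hm n)

namespace ConflationCalculus

variable {O : Type*} {T : O → O → O → Prop} {W : O → Prop}

/-- The calculus is self-dual: this turns each result on left resolutions into one on right
resolutions. -/
theorem op (h : ConflationCalculus T W) : ConflationCalculus (fun A B Z => T Z B A) W where
  pullback h₁ h₂ := (h.pushout h₁ h₂).imp fun _ ⟨a, b⟩ => ⟨b, a⟩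
  pushout h₁ h₂ := (h.pullback h₁ h₂).imp fun _ ⟨a, b⟩ => ⟨b, a⟩
  comp_deflation h₁ h₂ := h.comp_inflation h₂ h₁
  comp_inflation h₁ h₂ := h.comp_deflation h₂ h₁
  swap_right := h.swap_left
  swap_left := h.swap_right
  mid_mem hV hV' := h.mid_mem hV' hV

/-- Horseshoe lemma: left resolved objects are closed under extensions. -/
theorem leftResolved_extension (h : ConflationCalculus T W) {A B Z : O}
    (hA : LeftResolved T W A) (hZ : LeftResolved T W Z) (hT : T A B Z) :
    LeftResolved T W B := by
  refine ⟨fun B => ∃ A Z, LeftResolved T W A ∧ LeftResolved T W Z ∧ T A B Z,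
    ⟨A, Z, hA, hZ, hT⟩, ?_⟩
  rintro Y ⟨A, Z, hA, hZ, hT⟩
  obtain ⟨V, K, hV, hK, hKL⟩ := hA.step
  obtain ⟨V', K', hV', hK', hKL'⟩ := hZ.step
  -- `P` is an extension of `V'` by `A`. As `V'` is in `W` it splits, so `A` is also a quotient of
  -- `P`, and `V ⟶ A` can be pulled back to `M`, an extension of `V` by `V'`. The composite `M ⟶ P ⟶
  -- Y` has as syzygy an extension of `K'` by `K`.
  obtain ⟨P, hP, hP'⟩ := h.pullback hT hK'
  obtain ⟨M, hM, hM'⟩ := h.pullback hK (h.swap_right hV' hP)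
  obtain ⟨N, hN, hN'⟩ := h.comp_deflation hM hP'
  exact ⟨M, N, h.mid_mem hV' hV hM', hN, K, K', hKL, hKL', hN'⟩

/-- An object that is left resolved by left resolved objects is left resolved. -/
theorem leftResolved_of_leftResolved (h : ConflationCalculus T W) {X : O}
    (hX : LeftResolved T (LeftResolved T W) X) : LeftResolved T W X := by
  refine ⟨LeftResolved T (LeftResolved T W), hX, fun Y hY => ?_⟩
  obtain ⟨G, Y₁, hG, hT, hY₁⟩ := hY.step
  obtain ⟨V, G', hV, hGV, hG'⟩ := hG.step
  obtain ⟨K, hK, hK'⟩ := h.comp_deflation hGV hT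
  obtain ⟨G₁, Y₂, hG₁, hT₁, hY₂⟩ := hY₁.step
  obtain ⟨P, hP, hP'⟩ := h.pullback hK' hT₁
  obtain ⟨Q, hQ, hmem⟩ := hY₂
  -- `Q` witnesses a resolution of `Y₂`; adding `K` prepends the conflation `Y₂ ⟶ P ⟶ K`.
  refine ⟨V, K, hV, hK, fun Z => Q Z ∨ Z = K, Or.inr rfl, ?_⟩
  rintro Z (hZ | rfl)
  · obtain ⟨V, K, h₁, h₂, h₃⟩ := hmem Z hZ
    exact ⟨V, K, h₁, h₂, Or.inl h₃⟩
  · exact ⟨P, Y₂, h.leftResolved_extension hG' hG₁ hP, hP', Or.inl hQ⟩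

end ConflationCalculus

open scoped ZeroObject

/-! ### Long exact sequences and isomorphisms of triangles -/

section Basic

variable {C : Type u} [Category.{v} C]

section

variable (E : Cᵒᵖ ⥤ C ⥤ AddCommGrpCat.{w})

@[simp] theorem pull_id {Z A : C} (δ : Ext E Z A) : pull E (𝟙 Z) δ = δ := by
  simp [pull]

@[simp] theorem push_id {Z A : C} (δ : Ext E Z A) : push E (𝟙 A) δ = δ := by
  simp [push]

theorem pull_comp {Z Z' Z'' A : C} (c : Z'' ⟶ Z') (c' : Z' ⟶ Z) (δ : Ext E Z A) :
    pull E (c ≫ c') δ = pull E c (pull E c' δ) := by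
  simp [pull]

theorem push_comp {Z A A' A'' : C} (a : A ⟶ A') (a' : A' ⟶ A'') (δ : Ext E Z A) :
    push E (a ≫ a') δ = push E a' (push E a δ) := by
  simp [push]

theorem push_pull {Z Z' A A' : C} (c : Z' ⟶ Z) (a : A ⟶ A') (δ : Ext E Z A) :
    push E a (pull E c δ) = pull E c (push E a δ) :=
  (ConcreteCategory.congr_hom ((E.map c.op).naturality a) δ).symm

end

variable [Preadditive C] [HasBinaryBiproducts C]
variable {S : ExtriangulatedStructure.{w} C}

@[simp] theorem push_zero {Z A A' : C} (δ : Ext S.E Z A) : push S.E (0 : A ⟶ A') δ = 0 := by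
  have := S.additive_right (op Z)
  simp [push]

@[simp] theorem pull_zero {Z Z' A : C} (δ : Ext S.E Z A) : pull S.E (0 : Z' ⟶ Z) δ = 0 := by
  have := S.additive_left
  simp [pull]

variable (S) in
theorem exists_isTriangle {Z A : C} (δ : Ext S.E Z A) :
    ∃ (B : C) (x : A ⟶ B) (y : B ⟶ Z), IsTriangle S x y δ := by
  obtain ⟨⟨B, x, y⟩, h⟩ := Quotient.exists_rep (S.s δ)
  exact ⟨B, x, y, h.symm⟩

theorem IsTriangle.exists_iso {A B B' Z : C} {x : A ⟶ B} {y : B ⟶ Z} {x' : A ⟶ B'} {y' : B' ⟶ Z}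
    {δ : Ext S.E Z A} (h : IsTriangle S x y δ) (h' : IsTriangle S x' y' δ) :
    ∃ b : B ≅ B', x ≫ b.hom = x' ∧ b.hom ≫ y' = y :=
  Quotient.exact (Eq.trans (Eq.symm h) h')

variable [HasZeroObject C]

namespace IsTriangle

variable {A B Z : C} {x : A ⟶ B} {y : B ⟶ Z} {δ : Ext S.E Z A}

/-- Here and below, exactness is read off from maps to or from split triangles with one end term
`0`. -/
theorem comp_eq_zero (h : IsTriangle S x y δ) : x ≫ y = 0 := by
  obtain ⟨c, hc, -⟩ := S.et3 _ _ x y 0 δ (S.s_zero A 0) h (𝟙 A) (biprod.desc x 0) (by simp)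
  simpa using (biprod.inl ≫= hc).symm

theorem push_eq_zero (h : IsTriangle S x y δ) : push S.E x δ = 0 := by
  obtain ⟨c, -, hc⟩ := S.et3 x y _ _ δ 0 h (S.s_zero B 0) x biprod.inl rfl
  simpa using hc

theorem pull_eq_zero (h : IsTriangle S x y δ) : pull S.E y δ = 0 := by
  obtain ⟨a, -, ha⟩ := S.et3_op _ _ x y 0 δ (S.s_zero 0 B) h biprod.snd y rfl
  simpa using ha.symm

theorem exists_lift (h : IsTriangle S x y δ) {V : C} (f : V ⟶ B) (hf : f ≫ y = 0) :
    ∃ g : V ⟶ A, g ≫ x = f := by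
  obtain ⟨a, ha, -⟩ := S.et3_op _ _ x y 0 δ (S.s_zero V 0) h (biprod.fst ≫ f) 0 (by simp [hf])
  exact ⟨a, by simpa using ha.symm⟩

theorem exists_desc (h : IsTriangle S x y δ) {V : C} (f : B ⟶ V) (hf : x ≫ f = 0) :
    ∃ g : Z ⟶ V, y ≫ g = f := by
  obtain ⟨c, hc, -⟩ := S.et3 x y _ _ δ 0 h (S.s_zero 0 V) 0 (f ≫ biprod.inr) (by simp [reassoc_of% hf])
  exact ⟨c, by simpa using hc⟩

theorem exists_lift_iff (h : IsTriangle S x y δ) {V : C} (f : V ⟶ Z) :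
    (∃ g : V ⟶ B, g ≫ y = f) ↔ pull S.E f δ = 0 := by
  constructor
  · rintro ⟨g, rfl⟩
    rw [pull_comp, h.pull_eq_zero, map_zero]
  · intro hf
    obtain ⟨b, -, hb⟩ := S.realization _ _ x y 0 δ (S.s_zero 0 V) h 0 f (by simp [hf])
    exact ⟨biprod.inr ≫ b, by simp [← hb]⟩

theorem exists_desc_iff (h : IsTriangle S x y δ) {V : C} (f : A ⟶ V) :
    (∃ g : B ⟶ V, x ≫ g = f) ↔ push S.E f δ = 0 := by
  constructor
  · rintro ⟨g, rfl⟩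
    rw [push_comp, h.push_eq_zero, map_zero]
  · intro hf
    obtain ⟨b, hb, -⟩ := S.realization x y _ _ δ 0 h (S.s_zero V 0) f 0 (by simp [hf])
    exact ⟨b ≫ biprod.fst, by simp [reassoc_of% hb]⟩

/-- A morphism of triangles that is invertible on the outer terms is invertible. -/
theorem isIso_of_isIso (h : IsTriangle S x y δ) {A' B' Z' : C} {x' : A' ⟶ B'} {y' : B' ⟶ Z'}
    {δ' : Ext S.E Z' A'} (h' : IsTriangle S x' y' δ') (a : A ≅ A') (b : B ⟶ B') (c : Z ≅ Z')
    (hx : x ≫ b = a.hom ≫ x') (hy : y ≫ c.hom = b ≫ y')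
    (hδ : push S.E a.hom δ = pull S.E c.hom δ') : IsIso b := by
  have hδ' : push S.E a.inv δ' = pull S.E c.inv δ := by
    have := congrArg (fun t => push S.E a.inv (pull S.E c.inv t)) hδ
    simp only [← push_pull, ← pull_comp, ← push_comp] at this
    simpa [push_pull, ← pull_comp, ← push_comp] using this.symm
  -- `y' ≫ c.inv` lifts to some `t`, and `𝟙 - t ≫ b` dies under `y'`, so it factors through `x'`.
  -- This corrects `t` to a one-sided inverse; the other side is dual.
  have hr : ∃ r : B' ⟶ B, r ≫ b = 𝟙 B' := by
    obtain ⟨t, ht⟩ := (h.exists_lift_iff (y' ≫ c.inv)).2 (by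
      rw [pull_comp, ← hδ', ← push_pull, h'.pull_eq_zero, map_zero])
    obtain ⟨r, hr⟩ := h'.exists_lift (𝟙 B' - t ≫ b) (by simp [← hy, reassoc_of% ht])
    exact ⟨t + r ≫ a.inv ≫ x, by simp [hx, hr]⟩
  have hl : ∃ l : B' ⟶ B, b ≫ l = 𝟙 B := by
    obtain ⟨t, ht⟩ := (h'.exists_desc_iff (a.inv ≫ x)).2 (by
      rw [push_comp, hδ', push_pull, h.push_eq_zero, map_zero])
    obtain ⟨l, hl⟩ := h.exists_desc (𝟙 B - b ≫ t) (by simp [reassoc_of% hx, ht])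
    exact ⟨t + y' ≫ c.inv ≫ l, by simp [← reassoc_of% hy, hl]⟩
  obtain ⟨r, hr⟩ := hr
  obtain ⟨l, hl⟩ := hl
  have : r = l := by rw [← Category.comp_id r, ← hl, reassoc_of% hr]
  exact ⟨r, this ▸ hl, hr⟩

/-- The class of triangles is closed under isomorphisms. -/
theorem of_iso (h : IsTriangle S x y δ) {A' B' Z' : C} {x' : A' ⟶ B'} {y' : B' ⟶ Z'}
    {δ' : Ext S.E Z' A'} (a : A ≅ A') (b : B ≅ B') (c : Z ≅ Z')
    (hx : x ≫ b.hom = a.hom ≫ x') (hy : y ≫ c.hom = b.hom ≫ y')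
    (hδ : push S.E a.hom δ = pull S.E c.hom δ') : IsTriangle S x' y' δ' := by
  obtain ⟨M, m, e, hM⟩ := exists_isTriangle S δ'
  obtain ⟨t, ht, ht'⟩ := S.realization x y m e δ δ' h hM a.hom c.hom hδ
  have := h.isIso_of_isIso hM a t c ht ht' hδ
  refine Eq.trans hM (Quotient.sound ⟨(asIso t).symm ≪≫ b, ?_, ?_⟩)
  · rw [← cancel_epi a.hom]
    simp [← reassoc_of% ht, hx]
  · simp [← hy, ht']

theorem of_iso_right (h : IsTriangle S x y δ) {Z' : C} (c : Z ≅ Z') :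
    IsTriangle S x (y ≫ c.hom) (pull S.E c.inv δ) :=
  h.of_iso (Iso.refl _) (Iso.refl _) c (by simp) (by simp) (by simp [← pull_comp])

theorem of_iso_left (h : IsTriangle S x y δ) {A' : C} (a : A' ≅ A) :
    IsTriangle S (a.hom ≫ x) y (push S.E a.inv δ) :=
  h.of_iso a.symm (Iso.refl _) (Iso.refl _) (by simp) (by simp) (by simp)

theorem eq_zero_of_section (h : IsTriangle S x y δ) (s : Z ⟶ B) (hs : s ≫ y = 𝟙 Z) : δ = 0 := by
  simpa using (h.exists_lift_iff (𝟙 Z)).1 ⟨s, hs⟩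

theorem eq_zero_of_retraction (h : IsTriangle S x y δ) (r : B ⟶ A) (hr : x ≫ r = 𝟙 A) :
    δ = 0 := by
  simpa using (h.exists_desc_iff (𝟙 A)).1 ⟨r, hr⟩

end IsTriangle

/-! ### Split triangles and sums with trivial triangles. -/

theorem isTriangle_of_biprod_iso {A B Z : C} (b : A ⊞ Z ≅ B) :
    IsTriangle S (biprod.inl ≫ b.hom) (b.inv ≫ biprod.snd) (0 : Ext S.E Z A) :=
  IsTriangle.of_iso (S.s_zero A Z) (Iso.refl _) b (Iso.refl _) (by simp) (by simp) (by simp)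

theorem isTriangle_inr_fst (A Z : C) :
    IsTriangle S (biprod.inr : A ⟶ Z ⊞ A) biprod.fst (0 : Ext S.E Z A) :=
  IsTriangle.of_iso (S.s_zero A Z) (Iso.refl _) (biprod.braiding A Z) (Iso.refl _)
    (by ext <;> simp) (by simp) (by simp)

/-- The triangle `A ⟶ A ⊞ U ⟶ U` given by the graph of `a`. -/
theorem isTriangle_graph_left {A U : C} (a : A ⟶ U) :
    IsTriangle S (biprod.lift (𝟙 A) a) (biprod.desc a (-𝟙 U)) (0 : Ext S.E U A) :=
  IsTriangle.of_iso (S.s_zero A U) (Iso.refl _)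
    -- The shear `(p, q) ↦ (p, a p - q)` is its own inverse.
    ⟨biprod.lift biprod.fst (biprod.desc a (-𝟙 U)), biprod.lift biprod.fst (biprod.desc a (-𝟙 U)),
      by ext <;> simp, by ext <;> simp⟩ (Iso.refl _)
    (by ext <;> simp) (by ext <;> simp) (by simp)

theorem isTriangle_sum_left {A B Z : C} {x : A ⟶ B} {y : B ⟶ Z} {δ : Ext S.E Z A}
    (h : IsTriangle S x y δ) (U : C) :
    IsTriangle S (biprod.map x (𝟙 U)) (biprod.fst ≫ y) (push S.E biprod.inl δ) := by
  have h₀ : IsTriangle S (𝟙 U) (0 : U ⟶ 0) 0 :=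
    IsTriangle.of_iso (S.s_zero U 0) (Iso.refl _)
      ⟨biprod.fst, biprod.inl, by ext ; simp, by simp⟩ (Iso.refl _) (by simp)
      (by ext) (by simp)
  exact IsTriangle.of_iso (S.s_sum x y _ _ δ 0 h h₀) (Iso.refl _) (Iso.refl _)
    ⟨biprod.fst, biprod.inl, by ext ; simp, by simp⟩ (by simp) (by simp)
    (by simp [extSum, push_pull])

theorem isTriangle_sum_right {A B Z : C} {x : A ⟶ B} {y : B ⟶ Z} {δ : Ext S.E Z A}
    (h : IsTriangle S x y δ) (U : C) :
    IsTriangle S (x ≫ biprod.inr) (biprod.map (𝟙 U) y) (pull S.E biprod.snd δ) := by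
  have h₀ : IsTriangle S (0 : 0 ⟶ U) (𝟙 U) 0 :=
    IsTriangle.of_iso (S.s_zero 0 U) (Iso.refl _)
      ⟨biprod.snd, biprod.inr, by ext ; simp, by simp⟩ (Iso.refl _) (by ext)
      (by simp) (by simp)
  exact IsTriangle.of_iso (S.s_sum _ _ x y 0 δ h₀ h)
    ⟨biprod.snd, biprod.inr, by ext ; simp, by simp⟩ (Iso.refl _) (Iso.refl _)
    (by ext <;> simp) (by simp)
    (by simp [extSum, ← push_comp])

/-! ### Base change, cobase change, and pullback and pushout diagrams. -/

namespace IsTriangle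

variable {A B Z : C} {x : A ⟶ B} {y : B ⟶ Z} {δ : Ext S.E Z A}

/-- If `Hom(y, V)` is injective, so is `Hom(y', V)` for every base change `y'` of `y`. -/
theorem pull_epi (h : IsTriangle S x y δ) {Z' M : C} (c : Z' ⟶ Z) {x' : A ⟶ M} {y' : M ⟶ Z'}
    (h' : IsTriangle S x' y' (pull S.E c δ)) {V : C} (hV : ∀ k : Z ⟶ V, y ≫ k = 0 → k = 0)
    (k : Z' ⟶ V) (hk : y' ≫ k = 0) : k = 0 := by
  have hg : IsTriangle S (biprod.lift (𝟙 Z') c) (biprod.desc c (-𝟙 Z)) 0 :=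
    isTriangle_graph_left c
  -- This gives a triangle `G ⟶ Z' ⊞ B ⟶ Z` with `G ≅ M`, so the base change square is a weak
  -- pushout: `k` and the zero map on `B` come from one map on `Z`, which vanishes by `hV`.
  obtain ⟨G, i, d, e, δ'', hG, -, he, hde, -, -⟩ := S.et4_op _ _ _ _ _ _
    (isTriangle_sum_right h Z') hg
  rw [← pull_comp, biprod.lift_snd] at hde
  obtain ⟨b, -, hb⟩ := IsTriangle.exists_iso hde h'
  have he' : i ≫ biprod.fst = e := by simpa using he =≫ biprod.fst
  obtain ⟨t, ht⟩ := IsTriangle.exists_desc hG (biprod.fst ≫ k) (by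
    rw [reassoc_of% he', ← hb, Category.assoc, hk, comp_zero])
  have h₁ := biprod.inl ≫= ht
  have h₂ := biprod.inr ≫= ht
  simp at h₁ h₂
  rw [← h₁, hV t h₂, comp_zero]

/-- If `Hom(V, x)` is injective, so is `Hom(V, x')` for every cobase change `x'` of `x`. -/
theorem push_mono (h : IsTriangle S x y δ) {A' M : C} (a : A ⟶ A') {x' : A' ⟶ M} {y' : M ⟶ Z}
    (h' : IsTriangle S x' y' (push S.E a δ)) {V : C} (hV : ∀ k : V ⟶ A, k ≫ x = 0 → k = 0)
    (k : V ⟶ A') (hk : k ≫ x' = 0) : k = 0 := by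
  have hg : IsTriangle S (biprod.lift (𝟙 A) a) (biprod.desc a (-𝟙 A')) 0 :=
    isTriangle_graph_left a
  obtain ⟨G, i, d, e, δ'', hG, he, -, hde, -, -⟩ := S.et4 _ _ _ _ _ _ hg
    (isTriangle_sum_left h A')
  rw [← push_comp, biprod.inl_desc] at hde
  obtain ⟨b, hb, -⟩ := IsTriangle.exists_iso h' hde
  have he' : -d = biprod.inr ≫ i := by simpa using biprod.inr ≫= he
  obtain ⟨t, ht⟩ := IsTriangle.exists_lift hG (k ≫ biprod.inr) (by
    rw [Category.assoc, ← he', ← hb, Preadditive.comp_neg, reassoc_of% hk, zero_comp, neg_zero])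
  have h₁ := ht =≫ biprod.fst
  have h₂ := ht =≫ biprod.snd
  simp at h₁ h₂
  rw [← h₂, hV t h₁, zero_comp]

/-- The row of the pullback diagram of two deflations. -/
theorem exists_pull_of_push {D A₂ B₂ M : C} {j : D ⟶ M} {q : M ⟶ Z} {μ : Ext S.E Z D}
    (h : IsTriangle S j q μ) {f : A ⟶ D} {p : D ⟶ A₂} (hf : IsTriangle S f p 0) (r : D ⟶ A)
    (hr : f ≫ r = 𝟙 A) {x₂ : A₂ ⟶ B₂} {y₂ : B₂ ⟶ Z} (h₂ : IsTriangle S x₂ y₂ (push S.E p μ)) :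
    ∃ (m : A ⟶ M) (e : M ⟶ B₂), IsTriangle S m e (pull S.E y₂ (push S.E r μ)) := by
  obtain ⟨G, i, d, e, δ'', hG, -, -, hde, -, hp⟩ := S.et4 _ _ _ _ _ _ hf h
  obtain ⟨b, -, hb⟩ := IsTriangle.exists_iso hde h₂
  have hδ := congrArg (push S.E r) hp
  rw [← push_comp, hr, push_id, push_pull, ← hb, pull_comp] at hδ
  have := IsTriangle.of_iso_right hG b
  rw [hδ, ← pull_comp, b.inv_hom_id, pull_id] at this
  exact ⟨_, _, this⟩

/-- The column of the pushout diagram of two inflations. -/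
theorem exists_push_of_pull {D Z₂ B₂ M : C} {j : A ⟶ M} {q : M ⟶ D} {μ : Ext S.E D A}
    (h : IsTriangle S j q μ) {f : D ⟶ Z} {p : Z₂ ⟶ D} (hf : IsTriangle S p f 0) (r : Z ⟶ D)
    (hr : r ≫ f = 𝟙 Z) {x₂ : A ⟶ B₂} {y₂ : B₂ ⟶ Z₂} (h₂ : IsTriangle S x₂ y₂ (pull S.E p μ)) :
    ∃ (m : B₂ ⟶ M) (e : M ⟶ Z), IsTriangle S m e (push S.E x₂ (pull S.E r μ)) := by
  obtain ⟨G, i, d, e, δ'', hG, -, -, hde, -, hp⟩ := S.et4_op _ _ _ _ _ _ h hf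
  obtain ⟨b, hb, -⟩ := IsTriangle.exists_iso h₂ hde
  have hδ := congrArg (pull S.E r) hp
  rw [← pull_comp, hr, pull_id, ← push_pull, ← hb, push_comp] at hδ
  have := IsTriangle.of_iso_left hG b
  rw [← hδ, ← push_comp, b.hom_inv_id, push_id] at this
  exact ⟨_, _, this⟩

theorem exists_pullback {A₁ B₁ A₂ B₂ : C} {x₁ : A₁ ⟶ B₁} {y₁ : B₁ ⟶ Z} {δ₁ : Ext S.E Z A₁}
    {x₂ : A₂ ⟶ B₂} {y₂ : B₂ ⟶ Z} {δ₂ : Ext S.E Z A₂}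
    (h₁ : IsTriangle S x₁ y₁ δ₁) (h₂ : IsTriangle S x₂ y₂ δ₂) :
    ∃ (M : C) (m₁ : A₁ ⟶ M) (e₁ : M ⟶ B₂) (m₂ : A₂ ⟶ M) (e₂ : M ⟶ B₁),
      IsTriangle S m₁ e₁ (pull S.E y₂ δ₁) ∧ IsTriangle S m₂ e₂ (pull S.E y₁ δ₂) := by
  -- The common middle object realizes the extension by `A₁ ⊞ A₂` with components `δ₁` and `δ₂`;
  -- splitting off either summand gives one of the two triangles.
  obtain ⟨M, j, q, hM⟩ := exists_isTriangle S
    (push S.E (biprod.inl : A₁ ⟶ A₁ ⊞ A₂) δ₁ + push S.E biprod.inr δ₂)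
  obtain ⟨m₁, e₁, h₁'⟩ := hM.exists_pull_of_push (S.s_zero A₁ A₂) biprod.fst (by simp)
    (x₂ := x₂) (y₂ := y₂) (by simpa [← push_comp] using h₂)
  obtain ⟨m₂, e₂, h₂'⟩ := hM.exists_pull_of_push (f := biprod.inr) (p := biprod.fst)
    (isTriangle_inr_fst A₂ A₁) biprod.snd (by simp)
    (x₂ := x₁) (y₂ := y₁) (by simpa [← push_comp] using h₁)
  simp only [map_add, ← push_comp, biprod.inl_fst, biprod.inr_fst, biprod.inl_snd,
    biprod.inr_snd, push_id, push_zero, add_zero, zero_add] at h₁' h₂'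
  exact ⟨M, m₁, e₁, m₂, e₂, h₁', h₂'⟩

theorem exists_pushout {Z₁ B₁ Z₂ B₂ : C} {x₁ : A ⟶ B₁} {y₁ : B₁ ⟶ Z₁} {δ₁ : Ext S.E Z₁ A}
    {x₂ : A ⟶ B₂} {y₂ : B₂ ⟶ Z₂} {δ₂ : Ext S.E Z₂ A}
    (h₁ : IsTriangle S x₁ y₁ δ₁) (h₂ : IsTriangle S x₂ y₂ δ₂) :
    ∃ (M : C) (m₁ : B₁ ⟶ M) (e₁ : M ⟶ Z₂) (m₂ : B₂ ⟶ M) (e₂ : M ⟶ Z₁),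
      IsTriangle S m₁ e₁ (push S.E x₁ δ₂) ∧ IsTriangle S m₂ e₂ (push S.E x₂ δ₁) := by
  obtain ⟨M, j, q, hM⟩ := exists_isTriangle S
    (pull S.E (biprod.fst : Z₁ ⊞ Z₂ ⟶ Z₁) δ₁ + pull S.E biprod.snd δ₂)
  obtain ⟨m₁, e₁, h₁'⟩ := hM.exists_push_of_pull (S.s_zero Z₁ Z₂) biprod.inr (by simp)
    (x₂ := x₁) (y₂ := y₁) (by simpa [← pull_comp] using h₁)
  obtain ⟨m₂, e₂, h₂'⟩ := hM.exists_push_of_pull (p := biprod.inr) (f := biprod.fst)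
    (isTriangle_inr_fst Z₂ Z₁) biprod.inl (by simp)
    (x₂ := x₂) (y₂ := y₂) (by simpa [← pull_comp] using h₂)
  simp only [map_add, ← pull_comp, biprod.inl_fst, biprod.inr_fst, biprod.inl_snd,
    biprod.inr_snd, pull_id, pull_zero, add_zero, zero_add] at h₁' h₂'
  exact ⟨M, m₁, e₁, m₂, e₂, h₁', h₂'⟩

end IsTriangle

end Basic

/-! ### Triangles exact with respect to a class of objects -/

section Gorenstein

variable {C : Type u} [Category.{v} C] [Preadditive C] [HasBinaryBiproducts C]
variable {S : ExtriangulatedStructure.{w} C}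

/-- A triangle in `ξ` that is exact under `Hom(V, -)` and `Hom(-, V)` for all `V` in `W`. -/
def IsExactTriangle (ξ : TriangleClass S) (W : ObjectProperty C) {A B Z : C} (x : A ⟶ B)
    (y : B ⟶ Z) (δ : Ext S.E Z A) : Prop :=
  ξ x y δ ∧ ∀ V, W V → HomFromExact V x y ∧ HomToExact V x y

/-- There is an exact triangle with the given objects. -/
def Conflation (ξ : TriangleClass S) (W : ObjectProperty C) (A B Z : C) : Prop :=
  ∃ (x : A ⟶ B) (y : B ⟶ Z) (δ : Ext S.E Z A), IsExactTriangle ξ W x y δ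

variable {ξ : TriangleClass S}

theorem Conflation.mono {W W' : ObjectProperty C} (h : ∀ V, W V → W' V) {A B Z : C} :
    Conflation ξ W' A B Z → Conflation ξ W A B Z := by
  rintro ⟨x, y, δ, hξ, he⟩
  exact ⟨x, y, δ, hξ, fun V hV => he V (h V hV)⟩

variable [HasZeroObject C]

namespace IsTriangle

variable {A B Z : C} {x : A ⟶ B} {y : B ⟶ Z} {δ : Ext S.E Z A}

/-- Exactness in the middle is automatic for a triangle. Injectivity is not, since inflations need
not be monic. -/
theorem homFromExact_iff (h : IsTriangle S x y δ) (V : C) :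
    HomFromExact V x y ↔
      (∀ k : V ⟶ A, k ≫ x = 0 → k = 0) ∧ ∀ f : V ⟶ Z, ∃ g : V ⟶ B, g ≫ y = f := by
  constructor
  · rintro ⟨hi, -, hs⟩
    exact ⟨fun k hk => hi (by simpa using hk), hs⟩
  · rintro ⟨hi, hs⟩
    refine ⟨fun k l hkl => ?_, fun f => ⟨fun hf => h.exists_lift f hf, ?_⟩, hs⟩
    · exact sub_eq_zero.1 (hi (k - l) (by simpa [sub_eq_zero] using hkl))
    · rintro ⟨g, rfl⟩
      simp [h.comp_eq_zero]

theorem homToExact_iff (h : IsTriangle S x y δ) (V : C) :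
    HomToExact V x y ↔
      (∀ k : Z ⟶ V, y ≫ k = 0 → k = 0) ∧ ∀ f : A ⟶ V, ∃ g : B ⟶ V, x ≫ g = f := by
  constructor
  · rintro ⟨hi, -, hs⟩
    exact ⟨fun k hk => hi (by simpa using hk), hs⟩
  · rintro ⟨hi, hs⟩
    refine ⟨fun k l hkl => ?_, fun f => ⟨fun hf => h.exists_desc f hf, ?_⟩, hs⟩
    · exact sub_eq_zero.1 (hi (k - l) (by simpa [sub_eq_zero] using hkl))
    · rintro ⟨g, rfl⟩
      simp [reassoc_of% h.comp_eq_zero]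

end IsTriangle

theorem IsProperClass.isExactTriangle_iff (hξ : IsProperClass ξ) (W : ObjectProperty C)
    {A B Z : C} {x : A ⟶ B} {y : B ⟶ Z} {δ : Ext S.E Z A} :
    IsExactTriangle ξ W x y δ ↔ ξ x y δ ∧ ∀ V, W V →
      ((∀ k : V ⟶ A, k ≫ x = 0 → k = 0) ∧ ∀ f : V ⟶ Z, ∃ g : V ⟶ B, g ≫ y = f) ∧
      ((∀ k : Z ⟶ V, y ≫ k = 0 → k = 0) ∧ ∀ f : A ⟶ V, ∃ g : B ⟶ V, x ≫ g = f) := by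
  refine and_congr_right fun h => forall₂_congr fun V _ => ?_
  rw [(hξ.isTriangle h).homFromExact_iff, (hξ.isTriangle h).homToExact_iff]

/-- Saturation tests a triangle by base change along a deflation in `ξ`. For a deflation from a
`ξ`-projective object, projectivity lifts it through `h'` in two stages, so the base change splits.
-/
theorem IsProperClass.comp_inflation (hξ : IsProperClass ξ) (hproj : EnoughXiProjectives ξ)
    {X P Q V K N : C} {f : X ⟶ P} {f' : P ⟶ Q} {δ : Ext S.E Q X} {g : P ⟶ V} {h' : V ⟶ N}
    {d : Q ⟶ N} {e : N ⟶ K} {δ' : Ext S.E K Q} {δ'' : Ext S.E N X} (h : ξ f f' δ)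
    {g' : V ⟶ K} {ε : Ext S.E K P} (hg : ξ g g' ε) (hd : IsTriangle S d e δ')
    (hf : f' ≫ d = g ≫ h') (he : h' ≫ e = g')
    (hN : IsTriangle S (f ≫ g) h' δ'') : ξ (f ≫ g) h' δ'' := by
  obtain ⟨L, R, l, π, θ, hθ, hR⟩ := hproj N
  obtain ⟨-, -, hRδ⟩ := hR _ _ _ h
  obtain ⟨-, -, hRε⟩ := hR _ _ _ hg
  obtain ⟨t, ht⟩ := hRε (π ≫ e)
  obtain ⟨r, hr⟩ := hd.exists_lift (π - t ≫ h') (by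
    simp only at ht
    rw [Preadditive.sub_comp, Category.assoc, he, ht, sub_self])
  obtain ⟨q, rfl⟩ := hRδ r
  have hπ : pull S.E π δ'' = 0 :=
    (hN.exists_lift_iff π).1 ⟨t + q ≫ g, by
      simp only [Category.assoc, hf] at hr
      rw [Preadditive.add_comp, Category.assoc q, hr]
      abel⟩
  obtain ⟨M, m, c, hM⟩ := exists_isTriangle S (pull S.E π δ'')
  refine hξ.saturated hN hθ (m₁ := m) (e₁ := c) ?_
  rw [hπ] at hM ⊢
  exact hξ.split hM

/-! ### Exact triangles under base and cobase change. -/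

namespace IsExactTriangle

variable {W : ObjectProperty C} {A B Z : C} {x : A ⟶ B} {y : B ⟶ Z} {δ : Ext S.E Z A}

theorem pull (hξ : IsProperClass ξ) (h : IsExactTriangle ξ W x y δ) {Z' M : C} (c : Z' ⟶ Z)
    {x' : A ⟶ M} {y' : M ⟶ Z'} (h' : IsTriangle S x' y' (pull S.E c δ)) :
    IsExactTriangle ξ W x' y' (Extri.pull S.E c δ) := by
  rw [hξ.isExactTriangle_iff] at h ⊢
  have ht := hξ.isTriangle h.1
  obtain ⟨b, hb, -⟩ := S.realization x' y' x y _ δ h' ht (𝟙 A) c (push_id _ _)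
  rw [Category.id_comp] at hb
  refine ⟨hξ.base_change c h.1 h', fun V hV => ?_⟩
  obtain ⟨⟨h₁, h₂⟩, h₃, h₄⟩ := h.2 V hV
  refine ⟨⟨fun k hk => h₁ k (by rw [← hb, reassoc_of% hk, zero_comp]), fun f => ?_⟩,
    ht.pull_epi c h' h₃, fun f => ?_⟩
  -- `f` lifts through `y'` exactly when `f ≫ c` lifts through `y`: both say the same pulled back
  -- class is zero.
  · rw [h'.exists_lift_iff, ← pull_comp, ← ht.exists_lift_iff]
    exact h₂ _
  · obtain ⟨g, rfl⟩ := h₄ f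
    exact ⟨b ≫ g, by rw [reassoc_of% hb]⟩

theorem push (hξ : IsProperClass ξ) (h : IsExactTriangle ξ W x y δ) {A' M : C} (a : A ⟶ A')
    {x' : A' ⟶ M} {y' : M ⟶ Z} (h' : IsTriangle S x' y' (push S.E a δ)) :
    IsExactTriangle ξ W x' y' (Extri.push S.E a δ) := by
  rw [hξ.isExactTriangle_iff] at h ⊢
  have ht := hξ.isTriangle h.1
  obtain ⟨b, -, hb⟩ := S.realization x y x' y' δ _ ht h' a (𝟙 Z) (pull_id _ _).symm
  rw [Category.comp_id] at hb
  refine ⟨hξ.cobase_change a h.1 h', fun V hV => ?_⟩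
  obtain ⟨⟨h₁, h₂⟩, h₃, h₄⟩ := h.2 V hV
  refine ⟨⟨ht.push_mono a h' h₁, fun f => ?_⟩,
    fun k hk => h₃ k (by rw [hb, Category.assoc, hk, comp_zero]), fun f => ?_⟩
  · obtain ⟨g, rfl⟩ := h₂ f
    exact ⟨g ≫ b, by rw [Category.assoc, ← hb]⟩
  · rw [h'.exists_desc_iff, ← push_comp, ← ht.exists_desc_iff]
    exact h₄ _

end IsExactTriangle

/-! ### Splitting, pullback, pushout and composition of conflations. -/

namespace Conflation

variable {W : ObjectProperty C}

theorem of_iso_right (hξ : IsProperClass ξ) {A B Z Z' : C} (c : Z ≅ Z') :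
    Conflation ξ W A B Z → Conflation ξ W A B Z' := by
  rintro ⟨x, y, δ, h⟩
  exact ⟨_, _, _, h.pull hξ c.inv ((hξ.isTriangle h.1).of_iso_right c)⟩

theorem of_iso_left (hξ : IsProperClass ξ) {A A' B Z : C} (a : A ≅ A') :
    Conflation ξ W A B Z → Conflation ξ W A' B Z := by
  rintro ⟨x, y, δ, h⟩
  exact ⟨_, _, _, h.push hξ a.hom ((hξ.isTriangle h.1).of_iso_left a.symm)⟩

theorem of_biprod_iso (hξ : IsProperClass ξ) (W : ObjectProperty C) {A B Z : C}
    (b : A ⊞ Z ≅ B) : Conflation ξ W A B Z := by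
  have h := isTriangle_of_biprod_iso (S := S) b
  refine ⟨_, _, _, (hξ.isExactTriangle_iff W).2 ⟨hξ.split h, fun V _ => ⟨⟨fun k hk => ?_,
    fun f => ⟨f ≫ biprod.inr ≫ b.hom, by simp⟩⟩, fun k hk => ?_,
    fun f => ⟨b.inv ≫ biprod.fst ≫ f, by simp⟩⟩⟩⟩
  · simpa using hk =≫ (b.inv ≫ biprod.fst)
  · simpa using (biprod.inr ≫ b.hom) ≫= hk

theorem nonempty_iso_right (hξ : IsProperClass ξ) {A B V : C} (hV : W V)
    (h : Conflation ξ W A B V) : Nonempty (A ⊞ V ≅ B) := by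
  obtain ⟨x, y, δ, h⟩ := h
  have ht := hξ.isTriangle h.1
  obtain ⟨s, hs⟩ := (h.2 V hV).1.2.2 (𝟙 V)
  obtain rfl := ht.eq_zero_of_section s hs
  exact ⟨(IsTriangle.exists_iso (S.s_zero A V) ht).choose⟩

theorem nonempty_iso_left (hξ : IsProperClass ξ) {V B Z : C} (hV : W V)
    (h : Conflation ξ W V B Z) : Nonempty (V ⊞ Z ≅ B) := by
  obtain ⟨x, y, δ, h⟩ := h
  have ht := hξ.isTriangle h.1
  obtain ⟨r, hr⟩ := (h.2 V hV).2.2.2 (𝟙 V)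
  obtain rfl := ht.eq_zero_of_retraction r hr
  exact ⟨(IsTriangle.exists_iso (S.s_zero V Z) ht).choose⟩

theorem pullback (hξ : IsProperClass ξ) {K V X Y U : C} (h₁ : Conflation ξ W K V X)
    (h₂ : Conflation ξ W Y U X) : ∃ M, Conflation ξ W K M U ∧ Conflation ξ W Y M V := by
  obtain ⟨_, _, _, h₁⟩ := h₁
  obtain ⟨_, _, _, h₂⟩ := h₂
  obtain ⟨M, _, _, _, _, h₁', h₂'⟩ := (hξ.isTriangle h₁.1).exists_pullback (hξ.isTriangle h₂.1)
  exact ⟨M, ⟨_, _, _, h₁.pull hξ _ h₁'⟩, ⟨_, _, _, h₂.pull hξ _ h₂'⟩⟩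

theorem pushout (hξ : IsProperClass ξ) {A U Z V Z' : C} (h₁ : Conflation ξ W A U Z)
    (h₂ : Conflation ξ W A V Z') : ∃ M, Conflation ξ W U M Z' ∧ Conflation ξ W V M Z := by
  obtain ⟨_, _, _, h₁⟩ := h₁
  obtain ⟨_, _, _, h₂⟩ := h₂
  obtain ⟨M, _, _, _, _, h₁', h₂'⟩ := (hξ.isTriangle h₁.1).exists_pushout (hξ.isTriangle h₂.1)
  exact ⟨M, ⟨_, _, _, h₂.push hξ _ h₁'⟩, ⟨_, _, _, h₁.push hξ _ h₂'⟩⟩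

theorem comp_deflation (hξ : IsProperClass ξ) {K V P Q X : C} (h₁ : Conflation ξ W K V P)
    (h₂ : Conflation ξ W Q P X) : ∃ N, Conflation ξ W N V X ∧ Conflation ξ W K N Q := by
  obtain ⟨f', f, δ, h₁⟩ := h₁
  obtain ⟨g', g, δ', h₂⟩ := h₂
  obtain ⟨N, i, d, e, δ'', hN, hd, hi, hde, -, hp⟩ :=
    S.et4_op _ _ _ _ _ _ (hξ.isTriangle h₁.1) (hξ.isTriangle h₂.1)
  refine ⟨N, ⟨i, f ≫ g, δ'', (hξ.isExactTriangle_iff W).2 ⟨?_, fun V' hV' => ?_⟩⟩,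
    ⟨_, _, _, h₁.pull hξ _ hde⟩⟩
  · obtain ⟨M, m, c, hM⟩ := exists_isTriangle S (Extri.pull S.E g δ'')
    refine hξ.saturated hN h₂.1 (m₁ := m) (e₁ := c) ?_
    -- The base change of `δ''` along `g` is also a cobase change of `δ`, hence in `ξ`, so
    -- saturation applies.
    rw [← hp] at hM ⊢
    exact hξ.cobase_change d h₁.1 hM
  · obtain ⟨⟨a₁, a₂⟩, a₃, a₄⟩ := ((hξ.isExactTriangle_iff W).1 h₁).2 V' hV'
    obtain ⟨⟨b₁, b₂⟩, b₃, b₄⟩ := ((hξ.isExactTriangle_iff W).1 h₂).2 V' hV'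
    refine ⟨⟨fun k hk => ?_, fun u => ?_⟩, fun k hk => ?_, fun u => ?_⟩
    · obtain ⟨l, rfl⟩ := IsTriangle.exists_lift hde k
        (b₁ _ (by rw [Category.assoc, ← hi, reassoc_of% hk, zero_comp]))
      rw [a₁ l (by rw [← hd, ← Category.assoc, hk]), zero_comp]
    · obtain ⟨v, rfl⟩ := b₂ u
      obtain ⟨w, rfl⟩ := a₂ v
      exact ⟨w, by simp⟩
    · exact b₃ k (a₃ _ (by simpa using hk))
    -- Extend `u` on the subobject part first; the remaining error descends to `Q` and is extended
    -- along `g'`.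
    · obtain ⟨v, hv⟩ := a₄ (d ≫ u)
      obtain ⟨t, ht⟩ := IsTriangle.exists_desc hde (u - i ≫ v) (by
        rw [Preadditive.comp_sub, reassoc_of% hd, hv, sub_self])
      obtain ⟨r, rfl⟩ := b₄ t
      refine ⟨v + f ≫ r, ?_⟩
      rw [Preadditive.comp_add, reassoc_of% hi, ht]
      abel

theorem comp_inflation (hξ : IsProperClass ξ) (hproj : EnoughXiProjectives ξ) {X P Q V K : C}
    (h₁ : Conflation ξ W X P Q) (h₂ : Conflation ξ W P V K) :
    ∃ N, Conflation ξ W X V N ∧ Conflation ξ W Q N K := by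
  obtain ⟨f, f', δ, h₁⟩ := h₁
  obtain ⟨g, g', δ', h₂⟩ := h₂
  obtain ⟨N, i, d, e, δ'', hN, hd, hi, hde, -, -⟩ :=
    S.et4 _ _ _ _ _ _ (hξ.isTriangle h₁.1) (hξ.isTriangle h₂.1)
  refine ⟨N, ⟨_, _, _, (hξ.isExactTriangle_iff W).2
    ⟨hξ.comp_inflation hproj h₁.1 h₂.1 hde hd hi hN, fun V' hV' => ?_⟩⟩,
    ⟨_, _, _, h₂.push hξ _ hde⟩⟩
  obtain ⟨⟨a₁, a₂⟩, a₃, a₄⟩ := ((hξ.isExactTriangle_iff W).1 h₁).2 V' hV'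
  obtain ⟨⟨b₁, b₂⟩, b₃, b₄⟩ := ((hξ.isExactTriangle_iff W).1 h₂).2 V' hV'
  refine ⟨⟨fun k hk => ?_, fun u => ?_⟩, fun k hk => ?_, fun u => ?_⟩
  · exact a₁ k (b₁ _ (by simpa using hk))
  · obtain ⟨v, hv⟩ := b₂ (u ≫ e)
    obtain ⟨t, ht⟩ := IsTriangle.exists_lift hde (u - v ≫ i) (by
      rw [Preadditive.sub_comp, Category.assoc v, hi, hv, sub_self])
    obtain ⟨r, rfl⟩ := a₂ t
    refine ⟨v + r ≫ g, ?_⟩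
    rw [Preadditive.add_comp, Category.assoc r, ← hd, ← Category.assoc r, ht]
    abel
  · obtain ⟨l, rfl⟩ := IsTriangle.exists_desc hde k
      (a₃ _ (by rw [reassoc_of% hd, hk, comp_zero]))
    rw [b₃ l (by rw [← hi, Category.assoc, hk]), comp_zero]
  · obtain ⟨v, rfl⟩ := a₄ u
    obtain ⟨w, rfl⟩ := b₄ v
    exact ⟨w, by simp⟩

end Conflation

theorem conflationCalculus (hξ : IsProperClass ξ) (hproj : EnoughXiProjectives ξ)
    (W : ObjectProperty C) (hiso : W.IsClosedUnderIsomorphisms) (hsum : ClosedUnderSums W) :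
    ConflationCalculus (Conflation ξ W) W where
  pullback := Conflation.pullback hξ
  pushout := Conflation.pushout hξ
  comp_deflation := Conflation.comp_deflation hξ
  comp_inflation := Conflation.comp_inflation hξ hproj
  swap_right hV h := by
    obtain ⟨b⟩ := h.nonempty_iso_right hξ hV
    exact Conflation.of_biprod_iso hξ W (biprod.braiding _ _ ≪≫ b)
  swap_left hV h := by
    obtain ⟨b⟩ := h.nonempty_iso_left hξ hV
    exact Conflation.of_biprod_iso hξ W (biprod.braiding _ _ ≪≫ b)
  mid_mem hV hV' h := by
    obtain ⟨b⟩ := h.nonempty_iso_left hξ hV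
    exact W.prop_of_iso b (hsum _ _ hV hV')

/-! ### Gorenstein objects -/

/-- An object is Gorenstein if and only if it has left and right resolutions by exact
triangles. -/
theorem gorenstein_iff (hξ : IsProperClass ξ) (W : ObjectProperty C) (G : C) :
    Gorenstein ξ W G ↔ LeftResolved (Conflation ξ W) W G ∧
      LeftResolved (fun A B Z => Conflation ξ W Z B A) W G := by
  constructor
  · rintro ⟨R⟩
    have hT : ∀ n, Conflation ξ W (R.decomp.K (n + 1)) (R.X.X n) (R.decomp.K n) := fun n =>
      ⟨_, _, _, R.decomp.mem n, fun V hV => ⟨R.homFrom_exact V hV n, R.homTo_exact V hV n⟩⟩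
    constructor
    · refine ⟨fun Y => ∃ n, Nonempty (R.decomp.K n ≅ Y), ⟨0, ⟨R.iso⟩⟩, ?_⟩
      rintro Y ⟨n, ⟨i⟩⟩
      exact ⟨_, _, R.mem n, (hT n).of_iso_right hξ i, n + 1, ⟨Iso.refl _⟩⟩
    · refine ⟨fun Y => ∃ n, Nonempty (R.decomp.K n ≅ Y), ⟨0, ⟨R.iso⟩⟩, ?_⟩
      rintro Y ⟨n, ⟨i⟩⟩
      -- `K n` is the left term of the triangle of index `n - 1`.
      obtain ⟨m, rfl⟩ : ∃ m, n = m + 1 := ⟨n - 1, by simp⟩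
      exact ⟨_, _, R.mem m, (hT m).of_iso_left hξ i, m, ⟨Iso.refl _⟩⟩
  · rintro ⟨hL, hR⟩
    obtain ⟨a, ha₀, ha⟩ := hL.exists_seq
    obtain ⟨b, hb₀, hb⟩ := hR.exists_seq
    obtain ⟨K, hK₀, hK⟩ : ∃ K : ℤ → C, K 0 = G ∧
        ∀ n, ∃ V, W V ∧ Conflation ξ W (K (n + 1)) V (K n) := by
      -- The right resolution enters from `b 1` on, since `b 0` equals `a 0`; the triangle of index
      -- `-1` joins the two halves.
      refine ⟨fun n => match n with
        | Int.ofNat n => a n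
        | Int.negSucc n => b (n + 1), ha₀, fun n => ?_⟩
      match n with
      | Int.ofNat n => exact ha n
      | Int.negSucc 0 =>
        change ∃ V, W V ∧ Conflation ξ W (a 0) V (b 1)
        rw [ha₀, ← hb₀]
        exact hb 0
      | Int.negSucc (n + 1) => exact hb (n + 1)
    choose V hV g f δ h using hK
    have hgf : ∀ n, g n ≫ f n = 0 := fun n => (hξ.isTriangle (h n).1).comp_eq_zero
    exact ⟨{
      X := ChainComplex.of V (fun n => f (n + 1) ≫ g n) (fun n => by
        simp [reassoc_of% hgf])
      mem := hV
      decomp := {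
        K := K
        g := g
        f := f
        δ := δ
        mem := fun n => (h n).1
        d_eq := ChainComplex.of_d V (fun n => f (n + 1) ≫ g n) }
      homFrom_exact := fun U hU n => ((h n).2 U hU).1
      homTo_exact := fun U hU n => ((h n).2 U hU).2
      iso := eqToIso hK₀ }⟩

/-! ### Closure properties of the Gorenstein category. -/

theorem gorenstein_of_mem (hξ : IsProperClass ξ) (W : ObjectProperty C)
    (hsum : ClosedUnderSums W) {V : C} (hV : W V) : Gorenstein ξ W V := by
  -- `0` may lie outside `W`, so `V` is resolved by copies of `V ⊞ V`, all syzygies being `V`.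
  have h := Conflation.of_biprod_iso hξ W (Iso.refl (V ⊞ V))
  rw [gorenstein_iff hξ]
  constructor
  all_goals
    refine ⟨(· = V), rfl, ?_⟩
    rintro _ rfl
    exact ⟨_, _, hsum _ _ hV hV, h, rfl⟩

theorem closedUnderSums_gorenstein (hξ : IsProperClass ξ) (hproj : EnoughXiProjectives ξ)
    (W : ObjectProperty C) (hiso : W.IsClosedUnderIsomorphisms) (hsum : ClosedUnderSums W) :
    ClosedUnderSums (Gorenstein ξ W) := by
  intro A B hA hB
  have hc := conflationCalculus hξ hproj W hiso hsum
  have h := Conflation.of_biprod_iso hξ W (Iso.refl (A ⊞ B))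
  rw [gorenstein_iff hξ] at hA hB ⊢
  exact ⟨hc.leftResolved_extension hA.1 hB.1 h, hc.op.leftResolved_extension hB.2 hA.2 h⟩

theorem gorenstein_gorenstein (hξ : IsProperClass ξ) (hproj : EnoughXiProjectives ξ)
    (W : ObjectProperty C) (hiso : W.IsClosedUnderIsomorphisms) (hsum : ClosedUnderSums W) :
    Gorenstein ξ (Gorenstein ξ W) = Gorenstein ξ W := by
  have hc := conflationCalculus hξ hproj W hiso hsum
  ext G
  refine ⟨fun hG => ?_, gorenstein_of_mem hξ _
    (closedUnderSums_gorenstein hξ hproj W hiso hsum)⟩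
  rw [gorenstein_iff hξ] at hG ⊢
  obtain ⟨⟨P, hP, hP'⟩, Q, hQ, hQ'⟩ := hG
  have hm {A B Z : C} : Conflation ξ (Gorenstein ξ W) A B Z → Conflation ξ W A B Z :=
    Conflation.mono fun V => gorenstein_of_mem hξ W hsum
  constructor
  · refine hc.leftResolved_of_leftResolved ⟨P, hP, fun Y hY => ?_⟩
    obtain ⟨V, K, hV, hT, hK⟩ := hP' Y hY
    exact ⟨V, K, ((gorenstein_iff hξ W V).1 hV).1, hm hT, hK⟩
  · refine hc.op.leftResolved_of_leftResolved ⟨Q, hQ, fun Y hY => ?_⟩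
    obtain ⟨V, K, hV, hT, hK⟩ := hQ' Y hY
    exact ⟨V, K, ((gorenstein_iff hξ W V).1 hV).2, hm hT, hK⟩

theorem closedUnderSummands_gorenstein (hξ : IsProperClass ξ) (hproj : EnoughXiProjectives ξ)
    (W : ObjectProperty C) (hiso : W.IsClosedUnderIsomorphisms) (hsum : ClosedUnderSums W) :
    ClosedUnderSummands (Gorenstein ξ W) := by
  rintro G H H' ⟨i⟩ hG
  have hc := conflationCalculus hξ hproj W hiso hsum
  have h₁ : Conflation ξ W H G H' := Conflation.of_biprod_iso hξ W i.symm
  have h₂ : Conflation ξ W H' G H :=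
    Conflation.of_biprod_iso hξ W (biprod.braiding _ _ ≪≫ i.symm)
  rw [gorenstein_iff hξ] at hG ⊢
  constructor
  · refine hc.leftResolved_of_leftResolved ⟨fun Y => Y = H ∨ Y = H', Or.inl rfl, ?_⟩
    rintro Y (rfl | rfl)
    exacts [⟨G, _, hG.1, h₂, Or.inr rfl⟩, ⟨G, _, hG.1, h₁, Or.inl rfl⟩]
  · refine hc.op.leftResolved_of_leftResolved ⟨fun Y => Y = H ∨ Y = H', Or.inl rfl, ?_⟩
    rintro Y (rfl | rfl)
    exacts [⟨G, _, hG.2, h₁, Or.inr rfl⟩, ⟨G, _, hG.2, h₂, Or.inl rfl⟩]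

end Gorenstein

end Extri

theorem mainTheorem1 {C : Type u} [Category.{v} C] [Preadditive C] [HasZeroObject C] [HasBinaryBiproducts C]
    (S : Extri.ExtriangulatedStructure.{w} C) (ξ : Extri.TriangleClass S)
    (hξ : Extri.IsProperClass ξ)
    (hproj : Extri.EnoughXiProjectives ξ) (hinj : Extri.EnoughXiInjectives ξ)
    (hWIC : Extri.WIC S)
    (W : ObjectProperty C) (hiso : W.IsClosedUnderIsomorphisms) (hsum : Extri.ClosedUnderSums W) :
    (∀ n : ℕ, 1 ≤ n → Extri.GorensteinPow ξ W n = Extri.Gorenstein ξ W) ∧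
    Extri.ClosedUnderSummands (Extri.Gorenstein ξ W) := by
  refine ⟨fun n hn => ?_, Extri.closedUnderSummands_gorenstein hξ hproj W hiso hsum⟩
  induction n, hn using Nat.le_induction with
  | base => rfl
  | succ n _ ih =>
    rw [Extri.GorensteinPow, ih, Extri.gorenstein_gorenstein hξ hproj W hiso hsum]
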